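/- Let $a\in\mathbb{C}$ with $\operatorname{Re} a>0$ and let $f(z)=z+a+e^{-z}$. Let $g:\mathbb{C}\to\mathbb{C}$ be an entire function with an attracting fixed point at $0$, i.e. $g(0)=0$ and $|g'(0)|<1$, and let $h:\mathbb{C}^2\to\mathbb{C}$ be entire. Definitions. $\mathbb{C}$ and $\mathbb{C}^2$ are compactified to $\mathbb{P}^1$ (the Riemann sphere) and $\mathbb{P}^2$ by $z\mapsto[z:1]$ and $(z,w)\mapsto[z:w:1]$. A family of holomorphic maps $X\to\mathbb{C}^m$, $m\in\{1,2\}$, with $X\subset\mathbb{C}^m$ open, is normal if every sequence in it has a subsequence converging, uniformly on compact subsets of $X$, to a holomorphic map $X\to\mathbb{P}^m$. The Fatou set of an entire self-map of $\mathbb{C}^m$ is the set of points having an open neighbourhood on which its iterates form a normal family; Fatou components are the connected components of the Fatou set. A Baker domain of $f$ is a Fatou component $B$ with $f^p(B)\subset B$ for some $p\ge1$ such that $f^n(z)\to\infty$ for every $z\in B$. The order of $h$ in the first variable is $$\rho_1(h)=\limsup_{r_1\to\infty}\frac{\log^+\log M(r_1,r_2;h)}{\log r_1}\in[0,\infty],\qquad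 M(r_1,r_2;h)=\max_{|z|\le r_1,\ |w|\le r_2}|h(z,w)|,$$ for some $r_2>0$ (the value does not depend on $r_2$), where $\log^+x=\log\max(1,x)$, and $\log^+\log 0=0$. Theorem. Suppose that $\rho_1(h)<1$, or that $0$ is super-attracting for $g$ (i.e. $g'(0)=0$) and $\rho_1(h)<\infty$. Then the Baker domain $B$ of $f$, i.e. the one that contains the half plane $\{\operatorname{Re} z>R\}$ for every $R>|\log\operatorname{Re} a|$, exists and bulges for the skew product $$F:\mathbb{C}^2\to\mathbb{C}^2,\qquad F(z,w)=(f(z)+w\,h(z,w),\,g(w)),$$ that is, there is a Fatou component $\Omega$ of $F$ with $B\times\{0\}\subset\Omega\cap\{w=0\}$. -/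

import Mathlib

open Filter Topology Set
open scoped LinearAlgebra.Projectivization

noncomputable section

namespace BakerBulging

/-! ### Projective spaces, holomorphic maps into them, normal families -/

section Normality

variable {V : Type*} [NormedAddCommGroup V] [InnerProductSpace ℂ V]
variable {E : Type*} [NormedAddCommGroup E] [NormedSpace ℂ E]

/-- The chordal distance `√(1 - (|⟨u, v⟩| / (‖u‖ ‖v‖))²)` of two points `[u]`, `[v]` of the
projective space of `V`, i.e. the sine of their Fubini-Study distance.  It does not depend on the
representatives, see `chordalDist_mk`. -/
def chordalDist (p q : ℙ ℂ V) : ℝ :=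
  Real.sqrt (1 - (‖inner ℂ p.rep q.rep‖ / (‖p.rep‖ * ‖q.rep‖)) ^ 2)

theorem chordalDist_mk (u v : V) (hu : u ≠ 0) (hv : v ≠ 0) :
    chordalDist (Projectivization.mk ℂ u hu) (Projectivization.mk ℂ v hv) =
      Real.sqrt (1 - (‖inner ℂ u v‖ / (‖u‖ * ‖v‖)) ^ 2) := by
  obtain ⟨s, hs⟩ := Projectivization.exists_smul_eq_mk_rep ℂ u hu
  obtain ⟨t, ht⟩ := Projectivization.exists_smul_eq_mk_rep ℂ v hv
  have hs0 : ‖(s : ℂ)‖ ≠ 0 := norm_ne_zero_iff.2 s.ne_zero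
  have ht0 : ‖(t : ℂ)‖ ≠ 0 := norm_ne_zero_iff.2 t.ne_zero
  have hu0 : ‖u‖ ≠ 0 := norm_ne_zero_iff.2 hu
  have hv0 : ‖v‖ ≠ 0 := norm_ne_zero_iff.2 hv
  unfold chordalDist
  rw [← hs, ← ht, Units.smul_def, Units.smul_def, inner_smul_left, inner_smul_right,
    norm_smul, norm_smul, norm_mul, norm_mul, RCLike.norm_conj]
  congr 3
  field_simp

/-- `G` is a holomorphic map from (a neighbourhood of every point of) `X` to the projective space
of `V`: near every point it is `[φ]` for a holomorphic map `φ` without zeros. -/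
def HolomorphicOn (G : E → ℙ ℂ V) (X : Set E) : Prop :=
  ∀ x ∈ X, ∃ U : Set E, IsOpen U ∧ x ∈ U ∧ ∃ φ : E → V, DifferentiableOn ℂ φ U ∧
    ∀ y ∈ U, ∃ hy : φ y ≠ 0, G y = Projectivization.mk ℂ (φ y) hy

/-- A family of maps to the projective space of `V` is normal on `X`: every sequence in it has a
subsequence that converges, uniformly on the compact subsets of `X`, to a holomorphic map from `X`
to the projective space. -/
def IsNormalOn (A : Set (E → ℙ ℂ V)) (X : Set E) : Prop :=
  ∀ s : ℕ → E → ℙ ℂ V, (∀ n, s n ∈ A) →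
    ∃ k : ℕ → ℕ, StrictMono k ∧ ∃ G : E → ℙ ℂ V, HolomorphicOn G X ∧
      ∀ K : Set E, K ⊆ X → IsCompact K → ∀ ε : ℝ, 0 < ε →
        ∀ᶠ j in atTop, ∀ x ∈ K, chordalDist (s (k j) x) (G x) < ε

/-- The Fatou set of `F : E → E` with respect to the compactification `ι` of `E`: the points with
an open neighbourhood on which the iterates of `F`, viewed as maps to the compactification, form a
normal family. -/
def fatouSet (ι : E → ℙ ℂ V) (F : E → E) : Set E :=
  {x | ∃ X : Set E, IsOpen X ∧ x ∈ X ∧ IsNormalOn (range fun n : ℕ => ι ∘ F^[n]) X}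

/-- Fatou components: connected components of the Fatou set. -/
def IsFatouComponent (ι : E → ℙ ℂ V) (F : E → E) (Ω : Set E) : Prop :=
  ∃ x ∈ fatouSet ι F, Ω = connectedComponentIn (fatouSet ι F) x

end Normality

/-- The embedding `z ↦ [z : 1]` of `ℂ` into the Riemann sphere `ℙ¹`. -/
def toP1 (z : ℂ) : ℙ ℂ (EuclideanSpace ℂ (Fin 2)) :=
  Projectivization.mk ℂ !₂[z, 1] fun h => by
    have h1 := congrArg (fun v : EuclideanSpace ℂ (Fin 2) => v 1) h
    simp at h1

/-- The embedding `(z, w) ↦ [z : w : 1]` of `ℂ²` into `ℙ²`. -/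
def toP2 (p : ℂ × ℂ) : ℙ ℂ (EuclideanSpace ℂ (Fin 3)) :=
  Projectivization.mk ℂ !₂[p.1, p.2, 1] fun h => by
    have h1 := congrArg (fun v : EuclideanSpace ℂ (Fin 3) => v 2) h
    simp at h1

/-! ### Baker domains and bulging -/

/-- A Baker domain of `f : ℂ → ℂ`: a periodic Fatou component on which orbits tend to `∞`. -/
def IsBakerDomain (f : ℂ → ℂ) (B : Set ℂ) : Prop :=
  IsFatouComponent toP1 f B ∧ (∃ p : ℕ, 0 < p ∧ MapsTo f^[p] B B) ∧
    ∀ z ∈ B, Tendsto (fun n : ℕ => f^[n] z) atTop (cocompact ℂ)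

/-- The set `U` in the fiber `{w = 0}` bulges for `F`: it lies in a single Fatou component
of `F`. -/
def Bulges (F : ℂ × ℂ → ℂ × ℂ) (U : Set ℂ) : Prop :=
  ∃ Ω : Set (ℂ × ℂ), IsFatouComponent toP2 F Ω ∧ U ×ˢ {(0 : ℂ)} ⊆ Ω ∩ {p | p.2 = 0}

/-! ### Order in the first variable -/

/-- `M(r₁, r₂; h)`, the maximum of `|h(z, w)|` over `|z| ≤ r₁`, `|w| ≤ r₂`. -/
def maxModulus (h : ℂ × ℂ → ℂ) (r₁ r₂ : ℝ) : ℝ :=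
  sSup ((fun p => ‖h p‖) '' {p : ℂ × ℂ | ‖p.1‖ ≤ r₁ ∧ ‖p.2‖ ≤ r₂})

/-- The order of `h` in the first variable, computed with the radius `r₂` in the second one:
the upper limit, in the extended reals, of `log⁺ log M(r₁, r₂; h) / log r₁` as `r₁ → ∞`, where
`log⁺ x = log (max 1 x)`. -/
def orderFirst (h : ℂ × ℂ → ℂ) (r₂ : ℝ) : EReal :=
  limsup (fun r₁ : ℝ =>
    ((Real.log (max 1 (Real.log (maxModulus h r₁ r₂))) / Real.log r₁ : ℝ) : EReal)) atTop

/-! ### The maps -/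

/-- The Fatou function `f(z) = z + a + e^{-z}`. -/
def fatouFunction (a : ℂ) (z : ℂ) : ℂ := z + a + Complex.exp (-z)

/-- The skew product `F(z, w) = (f(z) + w h(z, w), g(w))`. -/
def skewProduct (f : ℂ → ℂ) (h : ℂ × ℂ → ℂ) (g : ℂ → ℂ) (p : ℂ × ℂ) : ℂ × ℂ :=
  (f p.1 + p.2 * h p, g p.2)

end BakerBulging

end

/-!
Let `A` be the set of points whose orbits under `f(z) = z + a + exp (-z)` enter the half plane
`H = {Re z > |log Re a|}`.  On `H` the term `exp (-z)` is smaller than `Re a`, so `H` is invariant,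
and near each point of `A` the real parts of the iterates grow at least linearly and uniformly
(`exists_linear_growth`).  Thus `A` is an open, `f`-invariant subset of the Fatou set of `f`.

The heart of the proof is that `A` is relatively closed in the Fatou set
(`closure_absorbedSet_inter_fatouSet_subset`), so that the Fatou component `B` containing `H` is
contained in `A`.  On a disc where the iterates are normal and which meets `A`, the identity theorem
applied to limit functions shows `fⁿ → ∞` uniformly
(`eventually_lt_norm_iterate_of_isNormalOn`).  Let `y` be a point of `A` in the disc.
Then `|fⁿ y| = O(n)`, and Harnack's inequality (`harnack_half`) for the positive harmonic functions
`log |fⁿ|` gives `|fⁿ| = O(n ^ 3)` near `y`.  From `exp (-fⁿ) = fⁿ⁺¹ - fⁿ - a` it follows that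
`Re fⁿ + O(log n)` is positive.  At `y` it is at least `c n`, hence by Harnack's inequality it is at
least `c n / 3` near `y`, so that `Re fⁿ → ∞` there (`ball_subset_absorbedSet`).

For the skew product, the first coordinates `z_n` of an orbit grow linearly as long as the
perturbation `w_n h(z_n, w_n)` is small.  For large `|z|` and bounded `w` one has
`|h(z, w)| ≤ exp (|z| ^ ρ)`, with `ρ < 1` or, in the super-attracting case, with some finite `ρ`,
whereas `w_n = gⁿ w` decays geometrically or like `2⁻¹ ^ 2 ^ n`, respectively.  So the perturbation
is uniformly small when `w` is small (`skewProduct_linear_growth`), and far to the right near the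
fiber `{w = 0}` the iterates of the skew product converge to `[1 : 0 : 0]` uniformly.  Every point
of `A × {0}` is moved there by some iterate, hence lies in the Fatou set of the skew product
(`mk_zero_mem_fatouSet_skewProduct`), and `B × {0}`, being connected, lies in a single component.
-/

namespace BakerBulging

open Metric InnerProductSpace

/-! ### Harnack's inequality -/

/-- Harnack's inequality on the disc of half the radius.  If `u = Re φ` with `φ c = p` real, the
Cayley transform `(φ - p) / (φ + p)` maps the disc to the unit disc and `c` to `0`, and the Schwarz
lemma bounds it by `1 / 2`. -/
theorem harnack_half {u : ℂ → ℝ} {c z : ℂ} {r : ℝ} (hu : HarmonicOnNhd u (ball c r))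
    (hpos : ∀ x ∈ ball c r, 0 < u x) (hz : z ∈ ball c (r / 2)) :
    u c / 3 ≤ u z ∧ u z ≤ 3 * u c := by
  have hr : 0 < r := by
    have := nonempty_ball.1 ⟨z, hz⟩
    linarith
  obtain ⟨F, hF, hFu⟩ := hu.exists_analyticOnNhd_ball_re_eq
  have hc : c ∈ ball c r := mem_ball_self hr
  have hzr : z ∈ ball c r := ball_subset_ball (by linarith) hz
  set p : ℝ := u c with hp
  have hp0 : 0 < p := hpos c hc
  set φ : ℂ → ℂ := fun x => F x - (F c).im * Complex.I with hφ
  have hφre : ∀ x ∈ ball c r, (φ x).re = u x := fun x hx => by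
    simpa [hφ] using hFu hx
  have hφc : φ c = p := by
    apply Complex.ext
    · simpa using hφre c hc
    · simp [hφ]
  have hφd : DifferentiableOn ℂ φ (ball c r) := hF.differentiableOn.sub_const _
  have hne : ∀ x ∈ ball c r, φ x + p ≠ 0 := fun x hx h0 => by
    have h1 := congrArg Complex.re h0
    have h2 := hpos x hx
    simp only [Complex.add_re, Complex.ofReal_re, Complex.zero_re, hφre x hx] at h1
    linarith
  have hle : ∀ x ∈ ball c r, ‖φ x - p‖ ≤ ‖φ x + p‖ := fun x hx => by
    rw [← sq_le_sq₀ (norm_nonneg _) (norm_nonneg _), Complex.sq_norm, Complex.sq_norm,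
      Complex.normSq_apply, Complex.normSq_apply]
    have h2 := mul_pos (hpos x hx) hp0
    simp only [Complex.sub_re, Complex.sub_im, Complex.add_re, Complex.add_im, Complex.ofReal_re,
      Complex.ofReal_im, hφre x hx]
    nlinarith
  set ψ : ℂ → ℂ := fun x => (φ x - p) / (φ x + p) with hψ
  have hψc : ψ c = 0 := by simp [hψ, hφc]
  have hS : dist (ψ z) (ψ c) ≤ 1 / r * dist z c := by
    refine Complex.dist_le_div_mul_dist_of_mapsTo_ball
      ((hφd.sub_const _).div (hφd.add_const _) hne) (fun x hx => ?_) hzr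
    rw [hψc, mem_closedBall_zero_iff, norm_div]
    exact div_le_one_of_le₀ (hle x hx) (norm_nonneg _)
  have hhalf : ‖ψ z‖ ≤ 1 / 2 := by
    rw [hψc, dist_zero_right] at hS
    refine hS.trans ?_
    rw [one_div, inv_mul_le_iff₀ hr]
    linarith [mem_ball.1 hz]
  rw [hψ, norm_div, div_le_iff₀ (norm_pos_iff.2 (hne z hzr)),
    ← sq_le_sq₀ (norm_nonneg _) (by positivity), mul_pow, Complex.sq_norm, Complex.sq_norm,
    Complex.normSq_apply, Complex.normSq_apply] at hhalf
  simp only [Complex.sub_re, Complex.sub_im, Complex.add_re, Complex.add_im, Complex.ofReal_re,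
      Complex.ofReal_im, hφre z hzr] at hhalf
  have key : (3 * u z - p) * (u z - 3 * p) ≤ 0 := by nlinarith [sq_nonneg (φ z).im]
  have huz := hpos z hzr
  constructor
  · by_contra! hlt
    nlinarith
  · by_contra! hlt
    nlinarith

/-! ### Chordal distances and normal families -/

section Normal

variable {V : Type*} [NormedAddCommGroup V] [InnerProductSpace ℂ V]
variable {E : Type*} [NormedAddCommGroup E] [NormedSpace ℂ E]

theorem chordalDist_self (p : ℙ ℂ V) : chordalDist p p = 0 := by
  have h0 : ‖p.rep‖ ≠ 0 := norm_ne_zero_iff.2 p.rep_nonzero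
  rw [chordalDist, inner_self_eq_norm_sq_to_K]
  simp [← sq, h0]

theorem holomorphicOn_const (q : ℙ ℂ V) (X : Set E) : HolomorphicOn (fun _ => q) X := fun _ _ =>
  ⟨univ, isOpen_univ, mem_univ _, fun _ => q.rep, differentiableOn_const _,
    fun _ _ => ⟨q.rep_nonzero, q.mk_rep.symm⟩⟩

/-- Iterates that converge uniformly to a point of projective space form a normal family: a
sequence of iterates either takes one iterate infinitely often, or has exponents tending to
infinity. -/
theorem isNormalOn_iterates {ι : E → ℙ ℂ V} {F : E → E} {X : Set E}
    (hol : ∀ n, HolomorphicOn (ι ∘ F^[n]) X) (q : ℙ ℂ V)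
    (hq : ∀ ε : ℝ, 0 < ε → ∀ᶠ n : ℕ in atTop, ∀ x ∈ X, chordalDist (ι (F^[n] x)) q < ε) :
    IsNormalOn (range fun n : ℕ => ι ∘ F^[n]) X := by
  intro s hs
  choose m hm using hs
  by_cases hfreq : ∃ c, ∃ᶠ j in atTop, m j = c
  · obtain ⟨c, hc⟩ := hfreq
    obtain ⟨k, hk, hkc⟩ := extraction_of_frequently_atTop hc
    refine ⟨k, hk, ι ∘ F^[c], hol c, fun K _ _ ε hε => Eventually.of_forall fun j x _ => ?_⟩
    rw [← hm, hkc]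
    simpa [chordalDist_self] using hε
  · push Not at hfreq
    have hm_top : Tendsto m atTop atTop := by
      refine Tendsto.mono_right ?_ Nat.cofinite_eq_atTop.le
      exact le_cofinite_iff_eventually_ne.2 hfreq
    refine ⟨id, strictMono_id, fun _ => q, holomorphicOn_const q X, fun K hK _ ε hε => ?_⟩
    filter_upwards [hm_top.eventually (hq ε hε)] with j hj x hx
    rw [id, ← hm]
    exact hj x (hK hx)

end Normal

/-- The point at infinity of the Riemann sphere. -/
noncomputable def inftyP1 : ℙ ℂ (EuclideanSpace ℂ (Fin 2)) :=
  Projectivization.mk ℂ !₂[1, 0] fun h => by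
    have h1 := congrArg (fun v : EuclideanSpace ℂ (Fin 2) => v 0) h
    simp at h1

/-- The point `[1 : 0 : 0]` of the line at infinity of `ℙ²`. -/
noncomputable def inftyP2 : ℙ ℂ (EuclideanSpace ℂ (Fin 3)) :=
  Projectivization.mk ℂ !₂[1, 0, 0] fun h => by
    have h1 := congrArg (fun v : EuclideanSpace ℂ (Fin 3) => v 0) h
    simp at h1

/-- Lagrange's identity expresses the chordal distance on the sphere by the determinant of
homogeneous coordinates. -/
theorem chordalDist_toP1_mk (z : ℂ) (v : EuclideanSpace ℂ (Fin 2)) (hv : v ≠ 0) :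
    chordalDist (toP1 z) (Projectivization.mk ℂ v hv) =
      ‖z * v 1 - v 0‖ / (Real.sqrt (1 + ‖z‖ ^ 2) * ‖v‖) := by
  have hv0 : 0 < ‖v‖ := norm_pos_iff.2 hv
  have hz0 : 0 < 1 + ‖z‖ ^ 2 := by positivity
  have hzn : ‖(!₂[z, 1] : EuclideanSpace ℂ (Fin 2))‖ = Real.sqrt (1 + ‖z‖ ^ 2) := by
    rw [EuclideanSpace.norm_eq]
    simp [Fin.sum_univ_two, add_comm]
  have hvn : ‖v‖ ^ 2 = ‖v 0‖ ^ 2 + ‖v 1‖ ^ 2 := by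
    rw [EuclideanSpace.norm_sq_eq, Fin.sum_univ_two]
  rw [toP1, chordalDist_mk, hzn]
  have hin : inner ℂ (!₂[z, 1] : EuclideanSpace ℂ (Fin 2)) v = v 0 * (starRingEnd ℂ) z + v 1 := by
    simp [PiLp.inner_apply, Fin.sum_univ_two]
  have hlag : ‖v 0 * (starRingEnd ℂ) z + v 1‖ ^ 2 + ‖z * v 1 - v 0‖ ^ 2 =
      (1 + ‖z‖ ^ 2) * ‖v‖ ^ 2 := by
    rw [hvn]
    simp only [Complex.sq_norm, Complex.normSq_apply, Complex.add_re, Complex.add_im,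
      Complex.sub_re, Complex.sub_im, Complex.mul_re, Complex.mul_im, Complex.conj_re,
      Complex.conj_im]
    ring
  rw [hin, Real.sqrt_eq_iff_eq_sq _ (by positivity)]
  · rw [div_pow, div_pow, mul_pow, Real.sq_sqrt hz0.le, eq_div_iff (by positivity), sub_mul,
      div_mul_cancel₀ _ (by positivity)]
    linarith
  · rw [div_pow, mul_pow, Real.sq_sqrt hz0.le, sub_nonneg, div_le_one (by positivity)]
    linarith [sq_nonneg ‖z * v 1 - v 0‖]

theorem chordalDist_toP1_mk_of_snd_eq_zero (z : ℂ) (v : EuclideanSpace ℂ (Fin 2)) (hv : v ≠ 0)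
    (h1 : v 1 = 0) :
    chordalDist (toP1 z) (Projectivization.mk ℂ v hv) = 1 / Real.sqrt (1 + ‖z‖ ^ 2) := by
  have hv0 : ‖v‖ ≠ 0 := norm_ne_zero_iff.2 hv
  have hvn : ‖v‖ = ‖v 0‖ := by
    rw [EuclideanSpace.norm_eq, Fin.sum_univ_two, h1]
    simp
  rw [chordalDist_toP1_mk, h1, mul_zero, zero_sub, norm_neg, ← hvn]
  field_simp

theorem chordalDist_toP1_inftyP1_lt {z : ℂ} {ε : ℝ} (hε : 0 < ε) (hz : 1 / ε < ‖z‖) :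
    chordalDist (toP1 z) inftyP1 < ε := by
  rw [inftyP1, chordalDist_toP1_mk_of_snd_eq_zero _ _ _ (by simp),
    div_lt_comm₀ (by positivity) hε]
  exact hz.trans (Real.lt_sqrt_of_sq_lt (by linarith))

/-- A limit in the sphere of a sequence of complex numbers tending to infinity is the point at
infinity. -/
theorem snd_eq_zero_of_tendsto {ζ : ℕ → ℂ} (hζ : Tendsto (fun j => ‖ζ j‖) atTop atTop)
    (v : EuclideanSpace ℂ (Fin 2)) (hv : v ≠ 0)
    (hd : Tendsto (fun j => chordalDist (toP1 (ζ j)) (Projectivization.mk ℂ v hv)) atTop (𝓝 0)) :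
    v 1 = 0 := by
  have hv0 : 0 < ‖v‖ := norm_pos_iff.2 hv
  have hlim : Tendsto (fun j => ‖v 0‖ / ‖ζ j‖ +
      2 * ‖v‖ * chordalDist (toP1 (ζ j)) (Projectivization.mk ℂ v hv)) atTop (𝓝 0) := by
    simpa using (hζ.const_div_atTop ‖v 0‖).add (hd.const_mul (2 * ‖v‖))
  refine norm_le_zero_iff.1 (ge_of_tendsto hlim ?_)
  filter_upwards [hζ.eventually_ge_atTop 1] with j hj
  have hpos : 0 < ‖ζ j‖ := by linarith
  have hs : Real.sqrt (1 + ‖ζ j‖ ^ 2) ≤ 2 * ‖ζ j‖ :=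
    Real.sqrt_le_iff.2 ⟨by positivity, by nlinarith⟩
  have htri : ‖ζ j‖ * ‖v 1‖ ≤ ‖v 0‖ + ‖ζ j * v 1 - v 0‖ := by
    rw [← norm_mul]
    linarith [norm_le_norm_add_norm_sub' (ζ j * v 1) (v 0)]
  have hc : ‖ζ j * v 1 - v 0‖ = chordalDist (toP1 (ζ j)) (Projectivization.mk ℂ v hv) *
      (Real.sqrt (1 + ‖ζ j‖ ^ 2) * ‖v‖) := by
    rw [chordalDist_toP1_mk, div_mul_cancel₀ _ (by positivity)]
  have hd0 : 0 ≤ chordalDist (toP1 (ζ j)) (Projectivization.mk ℂ v hv) := Real.sqrt_nonneg _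
  have h2 : chordalDist (toP1 (ζ j)) (Projectivization.mk ℂ v hv) *
      (Real.sqrt (1 + ‖ζ j‖ ^ 2) * ‖v‖) ≤
      chordalDist (toP1 (ζ j)) (Projectivization.mk ℂ v hv) * (2 * ‖ζ j‖ * ‖v‖) := by gcongr
  rw [← mul_le_mul_iff_right₀ hpos, mul_add, mul_div_cancel₀ _ hpos.ne']
  linarith

theorem chordalDist_toP2_inftyP2_lt {p : ℂ × ℂ} {C ε : ℝ} (hε : 0 < ε) (hw : ‖p.2‖ ≤ C)
    (hz : (1 + C ^ 2) / ε ^ 2 < ‖p.1‖ ^ 2) : chordalDist (toP2 p) inftyP2 < ε := by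
  have hn : ‖(!₂[p.1, p.2, 1] : EuclideanSpace ℂ (Fin 3))‖ ^ 2 = ‖p.1‖ ^ 2 + ‖p.2‖ ^ 2 + 1 := by
    rw [EuclideanSpace.norm_sq_eq, Fin.sum_univ_three]
    simp
  have hn1 : ‖(!₂[1, 0, 0] : EuclideanSpace ℂ (Fin 3))‖ = 1 := by
    rw [EuclideanSpace.norm_eq, Fin.sum_univ_three]
    simp
  have hin : ‖inner ℂ (!₂[p.1, p.2, 1] : EuclideanSpace ℂ (Fin 3)) !₂[1, 0, 0]‖ = ‖p.1‖ := by
    simp [PiLp.inner_apply, Fin.sum_univ_three]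
  rw [toP2, inftyP2, chordalDist_mk, hin, hn1, mul_one, div_pow, hn, Real.sqrt_lt' hε,
    sub_lt_iff_lt_add, ← sub_lt_iff_lt_add', lt_div_iff₀ (by positivity)]
  rw [div_lt_iff₀ (by positivity)] at hz
  have h2 : ‖p.2‖ ^ 2 ≤ C ^ 2 := by gcongr
  have h3 : 0 ≤ ε ^ 2 * (‖p.2‖ ^ 2 + 1) := by positivity
  nlinarith

theorem holomorphicOn_toP1_comp {G : ℂ → ℂ} (hG : Differentiable ℂ G) (X : Set ℂ) :
    HolomorphicOn (toP1 ∘ G) X := fun x _ => by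
  refine ⟨univ, isOpen_univ, mem_univ _, fun y => !₂[G y, 1], ?_, fun y _ => ⟨_, rfl⟩⟩
  rw [differentiableOn_univ, differentiable_euclidean]
  intro i
  fin_cases i
  · simpa using hG
  · simp

theorem holomorphicOn_toP2_comp {G : ℂ × ℂ → ℂ × ℂ} (hG : Differentiable ℂ G) (X : Set (ℂ × ℂ)) :
    HolomorphicOn (toP2 ∘ G) X := fun x _ => by
  refine ⟨univ, isOpen_univ, mem_univ _, fun y => !₂[(G y).1, (G y).2, 1], ?_,
    fun y _ => ⟨_, rfl⟩⟩
  rw [differentiableOn_univ, differentiable_euclidean]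
  intro i
  fin_cases i
  · simpa using hG.fst
  · simpa using hG.snd
  · simp

/-- Normality propagates escape: if the orbits of the points near one point of a disc tend to
infinity, then the iterates tend to infinity uniformly on the disc.  Otherwise some limit function
would not be constantly `∞` on the disc although it is `∞` near that point, contrary to the
identity theorem. -/
theorem eventually_lt_norm_iterate_of_isNormalOn {F : ℂ → ℂ} {X : Set ℂ}
    (hN : IsNormalOn (range fun n : ℕ => toP1 ∘ F^[n]) X) {c y : ℂ} {r : ℝ}
    (hX : closedBall c r ⊆ X) (hy : y ∈ closedBall c r)
    (hesc : ∀ᶠ x in 𝓝 y, x ∈ X ∧ Tendsto (fun n => ‖F^[n] x‖) atTop atTop) (M : ℝ) :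
    ∀ᶠ n : ℕ in atTop, ∀ x ∈ closedBall c r, M < ‖F^[n] x‖ := by
  by_contra hcon
  obtain ⟨m, hm, hmM⟩ := extraction_of_frequently_atTop (not_eventually.1 hcon)
  obtain ⟨k, hk, G, hG, hlim⟩ := hN (fun j => toP1 ∘ F^[m j]) fun j => ⟨m j, rfl⟩
  -- the points with image `∞`, in terms of homogeneous coordinates
  let Q : ℂ → Prop := fun x =>
    ∀ (v : EuclideanSpace ℂ (Fin 2)) (hv : v ≠ 0), G x = Projectivization.mk ℂ v hv → v 1 = 0
  have hQy : ∀ᶠ x in 𝓝 y, Q x := by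
    filter_upwards [hesc] with x hx v hv hGv
    refine snd_eq_zero_of_tendsto (ζ := fun j => F^[m (k j)] x)
      (hx.2.comp (hm.comp hk).tendsto_atTop) v hv ?_
    rw [Metric.tendsto_atTop']
    intro ε hε
    obtain ⟨N, hN⟩ := eventually_atTop.1 (hlim {x} (singleton_subset_iff.2 hx.1)
      isCompact_singleton ε hε)
    refine ⟨N, fun n hn => ?_⟩
    have h1 := hN n hn.le x rfl
    rw [hGv] at h1
    rwa [Real.dist_0_eq_abs, chordalDist, abs_of_nonneg (Real.sqrt_nonneg _)]
  have hQ : closedBall c r ⊆ {x | ∀ᶠ x' in 𝓝 x, Q x'} := by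
    refine (convex_closedBall c r).isPreconnected.subset_of_closure_inter_subset
      isOpen_setOfPred_eventually_nhds ⟨y, hy, hQy⟩ ?_
    rintro x ⟨hxcl, hxb⟩
    obtain ⟨U, hUo, hxU, φ, hφ, hφG⟩ := hG x (hX hxb)
    have han : AnalyticAt ℂ (fun x => φ x 1) x := by
      refine DifferentiableOn.analyticAt (s := U) ?_ (hUo.mem_nhds hxU)
      exact (differentiableOn_euclidean.1 hφ) 1
    rcases han.eventually_eq_zero_or_eventually_ne_zero with h0 | h0
    · filter_upwards [h0, hUo.mem_nhds hxU] with x' hx' hx'U v hv hGv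
      obtain ⟨hφ0, hGφ⟩ := hφG x' hx'U
      obtain ⟨t, ht⟩ := (Projectivization.mk_eq_mk_iff ℂ _ _ hv hφ0).1 (hGv.symm.trans hGφ)
      rw [← ht, Units.smul_def, PiLp.smul_apply, hx', smul_zero]
    · rw [eventually_nhdsWithin_iff] at h0
      obtain ⟨x', hx', hx'Q, hx'U⟩ :=
        ((mem_closure_iff_frequently.1 hxcl).and_eventually (h0.and (hUo.mem_nhds hxU))).exists
      by_cases hxx : x' = x
      · rwa [hxx] at hx'
      · obtain ⟨hφ0, hGφ⟩ := hφG x' hx'U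
        exact absurd ((Eventually.self_of_nhds hx') _ hφ0 hGφ) (hx'Q hxx)
  have hM : 0 < 1 + |M| := by positivity
  obtain ⟨j, hj⟩ := (hlim _ hX (isCompact_closedBall c r) (1 / (1 + |M|)) (by positivity)).exists
  refine hmM (k j) fun x hx => ?_
  have h1 := hj x hx
  obtain ⟨U, -, hxU, φ, -, hφG⟩ := hG x (hX hx)
  obtain ⟨hφ0, hGφ⟩ := hφG x hxU
  rw [hGφ, Function.comp_apply, chordalDist_toP1_mk_of_snd_eq_zero _ _ _
    ((Eventually.self_of_nhds (hQ hx)) _ hφ0 hGφ), one_div_lt_one_div (by positivity) hM,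
    Real.lt_sqrt hM.le] at h1
  by_contra! hle
  have h2 : ‖F^[m (k j)] x‖ ≤ |M| := hle.trans (le_abs_self M)
  nlinarith [norm_nonneg (F^[m (k j)] x), abs_nonneg M]

/-! ### The Baker domain of the Fatou function -/

section FatouFunction

variable {a : ℂ}

/-- The points whose orbit under the Fatou function enters the half plane
`{Re z > |log Re a|}`. -/
def absorbedSet (a : ℂ) : Set ℂ :=
  {z | ∃ n : ℕ, |Real.log a.re| < ((fatouFunction a)^[n] z).re}

theorem differentiable_fatouFunction (a : ℂ) : Differentiable ℂ (fatouFunction a) := by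
  unfold fatouFunction
  fun_prop

theorem norm_exp_neg_le {z : ℂ} {r : ℝ} (hz : r ≤ z.re) :
    ‖Complex.exp (-z)‖ ≤ Real.exp (-r) := by
  rw [Complex.norm_exp, Complex.neg_re]
  exact Real.exp_le_exp.2 (by linarith)

theorem exp_neg_lt_re (ha : 0 < a.re) {r : ℝ} (hr : |Real.log a.re| < r) :
    Real.exp (-r) < a.re := by
  rw [← Real.lt_log_iff_exp_lt ha]
  linarith [neg_abs_le (Real.log a.re)]

theorem le_re_fatouFunction_iterate (ha : 0 < a.re) {r : ℝ} (hr : |Real.log a.re| < r) {z : ℂ}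
    (hz : r ≤ z.re) (n : ℕ) :
    r + n * (a.re - Real.exp (-r)) ≤ ((fatouFunction a)^[n] z).re := by
  have hd := exp_neg_lt_re ha hr
  induction n with
  | zero => simpa using hz
  | succ n ih =>
    rw [Function.iterate_succ_apply']
    set y := (fatouFunction a)^[n] z
    have hn : 0 ≤ (n : ℝ) * (a.re - Real.exp (-r)) := mul_nonneg n.cast_nonneg (by linarith)
    have h1 := (Complex.abs_re_le_norm _).trans (norm_exp_neg_le (z := y) (r := r) (by linarith))
    have h2 := neg_abs_le (Complex.exp (-y)).re
    simp only [fatouFunction, Complex.add_re]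
    push_cast
    linarith

/-- Near an absorbed point the real parts of the iterates grow at least linearly, uniformly. -/
theorem exists_linear_growth (ha : 0 < a.re) {z : ℂ} (hz : z ∈ absorbedSet a) :
    ∃ c : ℝ, 0 < c ∧ ∃ N : ℕ, ∀ᶠ x in 𝓝 z, ∀ n ≥ N, c * n ≤ ((fatouFunction a)^[n] x).re := by
  obtain ⟨m, hm⟩ := hz
  obtain ⟨r, hr, hrm⟩ := exists_between hm
  have hd : 0 < a.re - Real.exp (-r) := sub_pos.2 (exp_neg_lt_re ha hr)
  have hr0 : 0 < r := (abs_nonneg _).trans_lt hr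
  -- for `n ≥ 2 m` at least half of the first `n` iterations take place in the half plane
  refine ⟨(a.re - Real.exp (-r)) / 2, half_pos hd, 2 * m, ?_⟩
  have hcont : Continuous fun x => ((fatouFunction a)^[m] x).re :=
    Complex.continuous_re.comp ((differentiable_fatouFunction a).continuous.iterate m)
  filter_upwards [hcont.continuousAt.eventually (lt_mem_nhds hrm)] with x hx n hn
  obtain ⟨k, rfl⟩ := Nat.exists_eq_add_of_le (show m ≤ n by lia)
  have hk : (m : ℝ) ≤ k := by
    exact_mod_cast (show m ≤ k by lia)
  have h1 := le_re_fatouFunction_iterate ha hr hx.le k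
  rw [add_comm m k, Function.iterate_add_apply]
  push_cast
  nlinarith

theorem isOpen_absorbedSet (a : ℂ) : IsOpen (absorbedSet a) := by
  rw [absorbedSet, Set.ofPred_exists]
  refine isOpen_iUnion fun n => ?_
  exact isOpen_lt continuous_const
    (Complex.continuous_re.comp ((differentiable_fatouFunction a).continuous.iterate n))

theorem fatouFunction_mem_absorbedSet (ha : 0 < a.re) {z : ℂ} (hz : z ∈ absorbedSet a) :
    fatouFunction a z ∈ absorbedSet a := by
  obtain ⟨n, hn⟩ := hz
  refine ⟨n, ?_⟩
  rw [← Function.iterate_succ_apply, Function.iterate_succ_apply']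
  have h1 := le_re_fatouFunction_iterate ha hn le_rfl 1
  have h2 := exp_neg_lt_re ha hn
  simp only [Function.iterate_one, Nat.cast_one] at h1
  linarith

theorem tendsto_norm_iterate_of_mem_absorbedSet (ha : 0 < a.re) {z : ℂ}
    (hz : z ∈ absorbedSet a) :
    Tendsto (fun n => ‖(fatouFunction a)^[n] z‖) atTop atTop := by
  obtain ⟨c, hc, N, hN⟩ := exists_linear_growth ha hz
  refine tendsto_atTop_mono' _ ?_ (tendsto_natCast_atTop_atTop.const_mul_atTop hc)
  filter_upwards [eventually_ge_atTop N] with n hn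
  exact (hN.self_of_nhds n hn).trans (Complex.re_le_norm _)

theorem absorbedSet_subset_fatouSet (ha : 0 < a.re) :
    absorbedSet a ⊆ fatouSet toP1 (fatouFunction a) := by
  intro z hz
  obtain ⟨c, hc, N, hN⟩ := exists_linear_growth ha hz
  obtain ⟨U, hU, hUo, hzU⟩ := _root_.eventually_nhds_iff.1 hN
  refine ⟨U, hUo, hzU, isNormalOn_iterates
    (fun n => holomorphicOn_toP1_comp ((differentiable_fatouFunction a).iterate n) U)
    inftyP1 fun ε hε => ?_⟩
  filter_upwards [eventually_ge_atTop N,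
    (tendsto_natCast_atTop_atTop.const_mul_atTop hc).eventually_gt_atTop (1 / ε)] with n hn h1 x hx
  exact chordalDist_toP1_inftyP1_lt hε
    (h1.trans_le ((hU x hx n hn).trans (Complex.re_le_norm _)))

theorem exists_norm_iterate_le_mul (ha : 0 < a.re) {y : ℂ} (hy : y ∈ absorbedSet a) :
    ∃ C : ℝ, 0 < C ∧ ∀ᶠ n : ℕ in atTop, ‖(fatouFunction a)^[n] y‖ ≤ C * n := by
  obtain ⟨c, hc, N, hN⟩ := exists_linear_growth ha hy
  have hN := hN.self_of_nhds
  have hstep : ∀ m : ℕ, ‖(fatouFunction a)^[N + m] y‖ ≤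
      ‖(fatouFunction a)^[N] y‖ + m * (‖a‖ + 1) := by
    intro m
    induction m with
    | zero => simp
    | succ m ih =>
      rw [← add_assoc, Function.iterate_succ_apply']
      have h0 := norm_exp_neg_le (r := 0) ((by positivity : 0 ≤ c * ((N + m : ℕ) : ℝ)).trans
        (hN (N + m) (by lia)))
      have h1 := norm_add₃_le (a := (fatouFunction a)^[N + m] y) (b := a)
        (c := Complex.exp (-(fatouFunction a)^[N + m] y))
      simp only [neg_zero, Real.exp_zero] at h0
      rw [fatouFunction]
      push_cast
      linarith
  refine ⟨‖(fatouFunction a)^[N] y‖ + (‖a‖ + 1), by positivity, ?_⟩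
  filter_upwards [eventually_ge_atTop N, eventually_ge_atTop 1] with n hn hn1
  obtain ⟨m, rfl⟩ := Nat.exists_eq_add_of_le hn
  have h2 : (1 : ℝ) ≤ ((N + m : ℕ) : ℝ) := by exact_mod_cast hn1
  refine (hstep m).trans ?_
  rw [add_mul]
  have h3 : (m : ℝ) ≤ ((N + m : ℕ) : ℝ) := by exact_mod_cast (show m ≤ N + m by lia)
  rw [mul_comm (m : ℝ)]
  gcongr
  exact le_mul_of_one_le_right (norm_nonneg _) h2

/-- If the iterates tend to infinity uniformly on a disc whose centre is absorbed, then all points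
near the centre are absorbed.  By Harnack's inequality for `log |fⁿ|`, the iterates grow at most
polynomially in `n`, so that `exp (-fⁿ) = fⁿ⁺¹ - fⁿ - a` yields `Re fⁿ ≥ -O(log n)`.  Harnack's
inequality for `Re fⁿ + O(log n)`, which is at least `c n` at the centre, concludes. -/
theorem ball_subset_absorbedSet (ha : 0 < a.re) {y : ℂ} {r : ℝ} (hr : 0 < r)
    (hy : y ∈ absorbedSet a)
    (hesc : ∀ᶠ n : ℕ in atTop, ∀ x ∈ ball y r, 1 < ‖(fatouFunction a)^[n] x‖) :
    ball y (r / 2 / 2) ⊆ absorbedSet a := by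
  intro x hx
  have hdiff : ∀ n x, AnalyticAt ℂ (fatouFunction a)^[n] x := fun n x =>
    ((differentiable_fatouFunction a).iterate n).analyticAt x
  obtain ⟨c, hc, N, hN⟩ := exists_linear_growth ha hy
  have hN := hN.self_of_nhds
  obtain ⟨C, hC, hCn⟩ := exists_norm_iterate_le_mul ha hy
  have hy_mem : ∀ {s : ℝ}, 0 < s → y ∈ ball y s := fun hs => mem_ball_self hs
  have hpoly : ∀ᶠ n : ℕ in atTop, ∀ x ∈ ball y (r / 2),
      ‖(fatouFunction a)^[n] x‖ ≤ (C * n) ^ 3 := by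
    filter_upwards [hesc, hCn] with n hn hnC x hx
    have hlog := (harnack_half (u := fun x => Real.log ‖(fatouFunction a)^[n] x‖)
      (fun x hx => (hdiff n x).harmonicAt_log_norm
        (norm_pos_iff.1 (one_pos.trans (hn x hx))))
      (fun x hx => Real.log_pos (hn x hx)) hx).2
    have hx1 := hn x (ball_subset_ball (by linarith) hx)
    have hy1 := hn y (hy_mem hr)
    have h3 : Real.log (‖(fatouFunction a)^[n] y‖ ^ 3) = 3 * Real.log ‖(fatouFunction a)^[n] y‖ := by
      rw [Real.log_pow]
      norm_num
    rw [← h3, Real.log_le_log_iff (by positivity) (by positivity)] at hlog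
    refine hlog.trans ?_
    gcongr
  -- `K (n + 1) ^ 3` strictly exceeds the bound for `|fⁿ⁺¹ - fⁿ - a|`
  set K : ℝ := 2 * C ^ 3 + ‖a‖ + 1 with hK
  have hK0 : 0 < K := by positivity
  have hlower : ∀ᶠ n : ℕ in atTop, ∀ x ∈ ball y (r / 2),
      0 < ((fatouFunction a)^[n] x).re + Real.log (K * (n + 1 : ℝ) ^ 3) := by
    filter_upwards [hpoly, (tendsto_add_atTop_nat 1).eventually hpoly] with n h0 h1 x hx
    have h0 := h0 x hx
    have h1 := h1 x hx
    rw [Function.iterate_succ_apply'] at h1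
    push_cast at h1
    set t := (fatouFunction a)^[n] x
    have hn0 : (0 : ℝ) ≤ n := n.cast_nonneg
    have hn1 : (1 : ℝ) ≤ (n + 1 : ℝ) ^ 3 := one_le_pow₀ (by linarith)
    have h0' : ‖t‖ ≤ (C * (n + 1)) ^ 3 := h0.trans (by gcongr; linarith)
    have hexp : Complex.exp (-t) = fatouFunction a t - t - a := by
      rw [fatouFunction]
      ring
    have hnorm : ‖Complex.exp (-t)‖ < K * (n + 1 : ℝ) ^ 3 := by
      rw [hexp]
      have h2 := norm_sub_le (fatouFunction a t - t) a
      have h3 := norm_sub_le (fatouFunction a t) t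
      have h4 : (‖a‖ + 1) * 1 ≤ (‖a‖ + 1) * (n + 1 : ℝ) ^ 3 := by gcongr
      rw [mul_pow] at h0' h1
      rw [hK]
      linarith
    rw [Complex.norm_exp, Complex.neg_re, ← Real.lt_log_iff_exp_lt (by positivity)] at hnorm
    linarith
  -- with the factor `3` from the cube, the logarithm costs at most `c / 6 * (n + 1)`, half of the
  -- lower bound `c / 3 * n` that Harnack's inequality transfers from the centre
  have hlogsmall : ∀ᶠ n : ℕ in atTop, Real.log ((n : ℝ) + 1) ≤ c / 18 * ((n : ℝ) + 1) := by
    have h1 := Real.isLittleO_log_id_atTop.def (c := c / 18) (by positivity)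
    have h2 := (tendsto_atTop_add_const_right atTop (1 : ℝ)
      (tendsto_natCast_atTop_atTop (R := ℝ))).eventually h1
    filter_upwards [h2] with n hn
    rw [id, Real.norm_eq_abs, Real.norm_of_nonneg (by positivity)] at hn
    exact (le_abs_self _).trans hn
  have hbig := (tendsto_natCast_atTop_atTop.const_mul_atTop
    (show 0 < c / 6 by positivity)).eventually_gt_atTop (Real.log K + c / 6 + |Real.log a.re|)
  obtain ⟨n, hn, hnl, hnb, hnN⟩ := (hlower.and (hlogsmall.and (hbig.and
    (eventually_ge_atTop N)))).exists
  refine ⟨n, ?_⟩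
  have hH := (harnack_half
    (u := fun x => ((fatouFunction a)^[n] x).re + Real.log (K * (n + 1 : ℝ) ^ 3))
    (fun x hx => ((hdiff n x).harmonicAt_re).add (by simp)) hn hx).1
  have hlogK : Real.log (K * (n + 1 : ℝ) ^ 3) = Real.log K + 3 * Real.log (n + 1) := by
    rw [Real.log_mul hK0.ne' (by positivity), Real.log_pow]
    norm_num
  have hypos := hn y (hy_mem (half_pos hr))
  have hynN := hN n hnN
  have hL0 : 0 ≤ Real.log (K * (n + 1 : ℝ) ^ 3) := by
    have : (1 : ℝ) ≤ (n + 1 : ℝ) ^ 3 := one_le_pow₀ (by linarith [n.cast_nonneg (α := ℝ)])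
    refine Real.log_nonneg (one_le_mul_of_one_le_of_one_le ?_ this)
    have : 0 ≤ 2 * C ^ 3 + ‖a‖ := by positivity
    linarith
  rw [hlogK] at hH hL0
  linarith

theorem closure_absorbedSet_inter_fatouSet_subset (ha : 0 < a.re) :
    closure (absorbedSet a) ∩ fatouSet toP1 (fatouFunction a) ⊆ absorbedSet a := by
  rintro z ⟨hzcl, X, hXo, hzX, hXN⟩
  obtain ⟨r, hr, hrX⟩ := nhds_basis_closedBall.mem_iff.1 (hXo.mem_nhds hzX)
  obtain ⟨y, hyA, hyz⟩ := mem_closure_iff.1 hzcl (r / 8) (by positivity)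
  have hyX : y ∈ closedBall z r := by
    rw [mem_closedBall, dist_comm]
    linarith
  have hesc := eventually_lt_norm_iterate_of_isNormalOn hXN hrX hyX
    (by
      filter_upwards [(isOpen_absorbedSet a).mem_nhds hyA, hXo.mem_nhds (hrX hyX)] with x hxA hxX
      exact ⟨hxX, tendsto_norm_iterate_of_mem_absorbedSet ha hxA⟩) 1
  refine ball_subset_absorbedSet ha (half_pos hr) hyA ?_ (mem_ball.2 (by linarith))
  filter_upwards [hesc] with n hn x hx
  refine hn x (mem_closedBall.2 ?_)
  have h1 := dist_triangle x y z
  rw [dist_comm y z] at h1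
  linarith [mem_ball.1 hx]

/-- A connected component of the Fatou set that contains an absorbed point consists of absorbed
points. -/
theorem connectedComponentIn_subset_absorbedSet (ha : 0 < a.re) {z : ℂ}
    (hz : z ∈ absorbedSet a) :
    connectedComponentIn (fatouSet toP1 (fatouFunction a)) z ⊆ absorbedSet a := by
  refine isPreconnected_connectedComponentIn.subset_of_closure_inter_subset (isOpen_absorbedSet a)
    ⟨z, mem_connectedComponentIn (absorbedSet_subset_fatouSet ha hz), hz⟩ ?_
  exact fun x hx => closure_absorbedSet_inter_fatouSet_subset ha
    ⟨hx.1, connectedComponentIn_subset _ _ hx.2⟩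

theorem exists_isBakerDomain (ha : 0 < a.re) :
    ∃ B : Set ℂ, IsBakerDomain (fatouFunction a) B ∧ IsPreconnected B ∧ B ⊆ absorbedSet a ∧
      {z : ℂ | |Real.log a.re| < z.re} ⊆ B := by
  set H : Set ℂ := {z : ℂ | |Real.log a.re| < z.re} with hH
  set z₀ : ℂ := ((|Real.log a.re| + 1 : ℝ) : ℂ) with hz₀
  have hz₀H : z₀ ∈ H := by simp [hH, hz₀]
  have hHA : H ⊆ absorbedSet a := fun z hz => ⟨0, hz⟩
  have hAF := absorbedSet_subset_fatouSet ha
  set B := connectedComponentIn (fatouSet toP1 (fatouFunction a)) z₀ with hB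
  have hBA : B ⊆ absorbedSet a := connectedComponentIn_subset_absorbedSet ha (hHA hz₀H)
  have hHB : H ⊆ B := (convex_halfSpace_re_gt _).isPreconnected.subset_connectedComponentIn hz₀H
    (hHA.trans hAF)
  have hfH : fatouFunction a z₀ ∈ H := by
    have h1 := le_re_fatouFunction_iterate ha hz₀H le_rfl 1
    have h2 := exp_neg_lt_re ha hz₀H
    have h3 : |Real.log a.re| < z₀.re := hz₀H
    simp only [Function.iterate_one, Nat.cast_one] at h1
    exact h3.trans (by linarith)
  refine ⟨B, ⟨⟨z₀, hAF (hHA hz₀H), rfl⟩, ⟨1, one_pos, ?_⟩, fun z hz => ?_⟩,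
    isPreconnected_connectedComponentIn, hBA, hHB⟩
  · have himage : fatouFunction a '' B ⊆ B := by
      have hBf : B = connectedComponentIn _ (fatouFunction a z₀) :=
        connectedComponentIn_eq (hHB hfH)
      rw [hBf]
      refine IsPreconnected.subset_connectedComponentIn
        (isPreconnected_connectedComponentIn.image _
          (differentiable_fatouFunction a).continuous.continuousOn)
        ⟨z₀, hBf ▸ hHB hz₀H, rfl⟩ ?_
      rw [← hBf]
      rintro _ ⟨x, hx, rfl⟩
      exact hAF (fatouFunction_mem_absorbedSet ha (hBA hx))
    exact fun x hx => himage ⟨x, hx, rfl⟩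
  · rw [← cobounded_eq_cocompact, ← tendsto_norm_atTop_iff_cobounded]
    exact tendsto_norm_iterate_of_mem_absorbedSet ha (hBA hz)

end FatouFunction

/-! ### Growth of functions of finite order in the first variable -/

theorem norm_le_maxModulus {h : ℂ × ℂ → ℂ} (hh : Continuous h) {r₁ r₂ : ℝ} {p : ℂ × ℂ}
    (h1 : ‖p.1‖ ≤ r₁) (h2 : ‖p.2‖ ≤ r₂) : ‖h p‖ ≤ maxModulus h r₁ r₂ := by
  refine le_csSup ?_ ⟨p, ⟨h1, h2⟩, rfl⟩
  have hK : {p : ℂ × ℂ | ‖p.1‖ ≤ r₁ ∧ ‖p.2‖ ≤ r₂} = closedBall 0 r₁ ×ˢ closedBall 0 r₂ := by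
    ext q
    simp
  rw [hK]
  exact (((isCompact_closedBall 0 r₁).prod (isCompact_closedBall 0 r₂)).image hh.norm).bddAbove

/-- A function of order less than `ρ` in the first variable is `O(exp (|z| ^ ρ))`. -/
theorem exists_norm_le_exp_rpow {h : ℂ × ℂ → ℂ} (hh : Continuous h) {r₂ ρ : ℝ}
    (hρ : orderFirst h r₂ < ρ) :
    ∃ r₀ : ℝ, ∀ t ≥ r₀, ∀ p : ℂ × ℂ, ‖p.1‖ ≤ t → ‖p.2‖ ≤ r₂ → ‖h p‖ ≤ Real.exp (t ^ ρ) := by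
  have hev := eventually_lt_of_limsup_lt hρ
  obtain ⟨r₀, hr₀⟩ := eventually_atTop.1 (hev.and (eventually_gt_atTop (1 : ℝ)))
  refine ⟨r₀, fun t ht p h1 h2 => (norm_le_maxModulus hh h1 h2).trans ?_⟩
  obtain ⟨hlt, ht1⟩ := hr₀ t ht
  have ht0 : 0 < t := by linarith
  rw [EReal.coe_lt_coe_iff, div_lt_iff₀ (Real.log_pos ht1), ← Real.log_rpow ht0,
    Real.log_lt_log_iff (by positivity) (by positivity)] at hlt
  exact (Real.le_exp_log _).trans (Real.exp_le_exp.2 ((le_max_right _ _).trans hlt.le))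

/-! ### Rate of attraction of the base map -/

/-- `ε` is a rate of attraction of `g` at the fixed point `0`: for all small `δ`, the orbits of the
points of the disc of radius `δ` are bounded by `δ * ε n`. -/
structure IsAttractionRate (g : ℂ → ℂ) (ε : ℕ → ℝ) : Prop where
  nonneg : ∀ n, 0 ≤ ε n
  le_one : ∀ n, ε n ≤ 1
  exists_bound : ∃ η : ℝ, 0 < η ∧ ∀ δ : ℝ, 0 < δ → δ ≤ η → ∀ w : ℂ, ‖w‖ ≤ δ →
    ∀ n : ℕ, ‖g^[n] w‖ ≤ δ * ε n

/-- Near an attracting fixed point the attraction is geometric. -/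
theorem exists_isAttractionRate_exp_linear {g : ℂ → ℂ} (hg : Differentiable ℂ g) (hg_fix : g 0 = 0)
    (hg_attr : ‖deriv g 0‖ < 1) :
    ∃ s : ℝ, 0 < s ∧ IsAttractionRate g fun n => Real.exp (-(s * n)) := by
  obtain ⟨l, hl, hl1⟩ := exists_between hg_attr
  have hl0 : 0 < l := (norm_nonneg _).trans_lt hl
  have hlog : 0 < -Real.log l := neg_pos.2 (Real.log_neg hl0 hl1)
  refine ⟨-Real.log l, hlog, fun n => (Real.exp_pos _).le, fun n => ?_, ?_⟩
  · rw [Real.exp_le_one_iff, neg_nonpos]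
    positivity
  · have hO := (hg 0).hasDerivAt.isLittleO.def (sub_pos.2 hl)
    obtain ⟨η, hη, hball⟩ := nhds_basis_closedBall.eventually_iff.1 hO
    have hcontr : ∀ w : ℂ, ‖w‖ ≤ η → ‖g w‖ ≤ l * ‖w‖ := fun w hw => by
      have h1 := hball (mem_closedBall_zero_iff.2 hw)
      rw [hg_fix, sub_zero, sub_zero, smul_eq_mul] at h1
      have h2 := norm_le_norm_add_norm_sub' (g w) (w * deriv g 0)
      rw [norm_mul] at h2
      linarith
    refine ⟨η, hη, fun δ hδ hδη w hw n => ?_⟩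
    have hpow : ∀ n : ℕ, Real.exp (-(-Real.log l * n)) = l ^ n := fun n => by
      rw [neg_mul, neg_neg, mul_comm, Real.exp_nat_mul, Real.exp_log hl0]
    rw [hpow]
    induction n with
    | zero => simpa using hw
    | succ n ih =>
      have h1 : δ * l ^ n ≤ δ * 1 := by
        gcongr
        exact pow_le_one₀ hl0.le hl1.le
      rw [Function.iterate_succ_apply', pow_succ]
      have h2 := hcontr _ (ih.trans (by linarith))
      have h3 : l * ‖g^[n] w‖ ≤ l * (δ * l ^ n) := by gcongr
      linarith

/-- Near a super-attracting fixed point `|g w| ≤ C |w| ^ 2`, hence for `C δ ≤ 1 / 2` the iterates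
are bounded by `δ * 2⁻¹ ^ (2 ^ n - 1)`. -/
theorem isAttractionRate_exp_two_pow {g : ℂ → ℂ} (hg : Differentiable ℂ g)
    (hg_fix : g 0 = 0) (hg_deriv : deriv g 0 = 0) :
    IsAttractionRate g fun n => Real.exp (-(Real.log 2 * (2 ^ n - 1))) := by
  have hlog : 0 < Real.log 2 := Real.log_pos one_lt_two
  refine ⟨fun n => (Real.exp_pos _).le, fun n => ?_, ?_⟩
  · rw [Real.exp_le_one_iff, neg_nonpos]
    have : (1 : ℝ) ≤ 2 ^ n := one_le_pow₀ one_le_two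
    exact mul_nonneg hlog.le (by linarith)
  · obtain ⟨C, hC⟩ := ((isCompact_closedBall (0 : ℂ) 1).image hg.continuous.norm).bddAbove
    have hC0 : 0 ≤ C := (norm_nonneg (g 0)).trans (hC ⟨0, by simp, rfl⟩)
    -- the Schwarz lemma at a double zero
    have hquad : ∀ w : ℂ, ‖w‖ < 1 → ‖g w‖ ≤ C * ‖w‖ ^ 2 := fun w hw => by
      have hO := (hg 0).hasDerivAt.isLittleO
      rw [hg_deriv] at hO
      have h1 := Complex.dist_le_mul_div_pow_of_mapsTo_ball_of_isLittleO (f := g) (c := 0)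
        (R₁ := 1) (R₂ := C) (n := 1) (z := w) hg.differentiableOn
        (fun x hx => by
          rw [hg_fix, mem_closedBall_zero_iff]
          exact hC ⟨x, ball_subset_closedBall hx, rfl⟩)
        (by
          simp only [pow_one]
          simpa using hO.norm_right) (mem_ball_zero_iff.2 hw)
      simpa [hg_fix] using h1
    refine ⟨1 / (2 * (C + 1)), by positivity, fun δ hδ hδη w hw n => ?_⟩
    have hδC : C * δ ≤ 1 / 2 := by
      rw [le_div_iff₀ (by positivity)] at hδη
      nlinarith
    have hδ1 : δ < 1 := by
      rw [le_div_iff₀ (by positivity)] at hδη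
      nlinarith
    induction n with
    | zero => simpa using hw
    | succ n ih =>
      set e := Real.exp (-(Real.log 2 * (2 ^ n - 1))) with he
      have he0 : 0 < e := Real.exp_pos _
      have he1 : e ≤ 1 := by
        rw [he, Real.exp_le_one_iff, neg_nonpos]
        have : (1 : ℝ) ≤ 2 ^ n := one_le_pow₀ one_le_two
        exact mul_nonneg hlog.le (by linarith)
      have hsucc : Real.exp (-(Real.log 2 * (2 ^ (n + 1) - 1))) = 1 / 2 * e ^ 2 := by
        have h2 : Real.exp (-Real.log 2) = 1 / 2 := by
          rw [Real.exp_neg, Real.exp_log two_pos, one_div]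
        rw [he, ← h2, ← Real.exp_nat_mul, ← Real.exp_add]
        congr 1
        push_cast
        ring
      rw [Function.iterate_succ_apply', hsucc]
      have h1 : ‖g^[n] w‖ < 1 := by nlinarith
      calc ‖g (g^[n] w)‖ ≤ C * ‖g^[n] w‖ ^ 2 := hquad _ h1
        _ ≤ C * (δ * e) ^ 2 := by gcongr
        _ = (C * δ) * (δ * e ^ 2) := by ring
        _ ≤ 1 / 2 * (δ * e ^ 2) := by gcongr
        _ = δ * (1 / 2 * e ^ 2) := by ring

theorem exists_exp_mul_exp_le {u v : ℕ → ℝ} (huv : ∀ᶠ n in atTop, v n ≤ u n) :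
    ∃ C : ℝ, ∀ n, Real.exp (-u n) * Real.exp (v n) ≤ C := by
  have hb : IsBoundedUnder (· ≤ ·) atTop fun n => Real.exp (-u n) * Real.exp (v n) := by
    refine isBoundedUnder_of_eventually_le (a := 1) ?_
    filter_upwards [huv] with n hn
    rw [← Real.exp_add, Real.exp_le_one_iff]
    linarith
  obtain ⟨C, hC⟩ := hb.bddAbove_range
  exact ⟨C, fun n => hC ⟨n, rfl⟩⟩

/-- Under either assumption on the order of `h`, the fiber coordinate of the skew product decays
fast enough to dominate the growth of `h` along sequences of linear growth. -/
theorem exists_attractionRate_dominating {g : ℂ → ℂ} (hg : Differentiable ℂ g)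
    (hg_fix : g 0 = 0) (hg_attr : ‖deriv g 0‖ < 1) {h : ℂ × ℂ → ℂ} {r₂ : ℝ}
    (horder : orderFirst h r₂ < 1 ∨ (deriv g 0 = 0 ∧ orderFirst h r₂ < ⊤)) :
    ∃ (ε : ℕ → ℝ) (ρ : ℝ), IsAttractionRate g ε ∧ orderFirst h r₂ < ρ ∧
      ∀ A B : ℝ, 0 < B → ∃ C : ℝ, ∀ n : ℕ, ε n * Real.exp ((A + B * n) ^ ρ) ≤ C := by
  have hlin : ∀ A B : ℝ, 0 < B → Tendsto (fun n : ℕ => A + B * n) atTop atTop := fun A B hB =>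
    tendsto_atTop_add_const_left _ _ (tendsto_natCast_atTop_atTop.const_mul_atTop hB)
  rcases horder with h1 | ⟨hd, htop⟩
  · obtain ⟨ρ, hρ, hρ1⟩ := EReal.lt_iff_exists_real_btwn.1 h1
    have hρ1 : ρ < 1 := by exact_mod_cast hρ1
    obtain ⟨s, hs, hrate⟩ := exists_isAttractionRate_exp_linear hg hg_fix hg_attr
    refine ⟨_, ρ, hrate, hρ, fun A B hB => exists_exp_mul_exp_le ?_⟩
    -- `x ^ ρ = o(x)` along `x = A + B n`
    have hto : Tendsto (fun x : ℝ => x ^ (-(1 - ρ))) atTop (𝓝 0) :=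
      tendsto_rpow_neg_atTop (by linarith)
    have hc : 0 < s / (2 * B) := by positivity
    filter_upwards [(hlin A B hB).eventually (hto.eventually (gt_mem_nhds hc)),
      (hlin A B hB).eventually_gt_atTop 0,
      (tendsto_natCast_atTop_atTop.const_mul_atTop hB).eventually_ge_atTop A] with n hn hn0 hnA
    have hsplit : (A + B * n) ^ ρ = (A + B * n) ^ (-(1 - ρ)) * (A + B * n) := by
      rw [← Real.rpow_add_one hn0.ne']
      congr 1
      ring
    rw [hsplit]
    calc (A + B * n) ^ (-(1 - ρ)) * (A + B * n) ≤ s / (2 * B) * (B * n + B * n) := by gcongr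
      _ = s * n := by field_simp; ring
  · obtain ⟨ρ, hρ, -⟩ := EReal.lt_iff_exists_real_btwn.1 htop
    refine ⟨_, ρ, isAttractionRate_exp_two_pow hg hg_fix hd, hρ, fun A B hB =>
      exists_exp_mul_exp_le ?_⟩
    have hlog : 0 < Real.log 2 := Real.log_pos one_lt_two
    -- `x ^ ρ = o(exp (log 2 / B * x))`, and the right-hand side is a multiple of `2 ^ n` along
    -- `x = A + B n`
    have hO := (isLittleO_rpow_exp_pos_mul_atTop ρ (show 0 < Real.log 2 / B by positivity)).def
      (show 0 < Real.log 2 / (2 * Real.exp (Real.log 2 / B * A)) by positivity)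
    filter_upwards [(hlin A B hB).eventually hO, eventually_ge_atTop 1] with n hn hn1
    have hexp : Real.exp (Real.log 2 / B * (A + B * n)) =
        Real.exp (Real.log 2 / B * A) * 2 ^ n := by
      rw [mul_add, Real.exp_add, ← mul_assoc, div_mul_cancel₀ _ hB.ne', mul_comm (Real.log 2) n,
        Real.exp_nat_mul, Real.exp_log two_pos]
    rw [Real.norm_of_nonneg (Real.exp_pos _).le, hexp] at hn
    have h2 : (2 : ℝ) ≤ 2 ^ n := le_self_pow₀ one_le_two (by lia)
    calc (A + B * n) ^ ρ ≤ _ := (le_abs_self _).trans hn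
      _ = Real.log 2 * (2 ^ n / 2) := by field_simp
      _ ≤ Real.log 2 * (2 ^ n - 1) := by gcongr; linarith

/-! ### The Fatou set of the skew product -/

theorem differentiable_skewProduct {f g : ℂ → ℂ} {h : ℂ × ℂ → ℂ} (hf : Differentiable ℂ f)
    (hg : Differentiable ℂ g) (hh : Differentiable ℂ h) :
    Differentiable ℂ (skewProduct f h g) := by
  unfold skewProduct
  fun_prop

theorem snd_skewProduct_iterate (f g : ℂ → ℂ) (h : ℂ × ℂ → ℂ) (p : ℂ × ℂ) (n : ℕ) :
    ((skewProduct f h g)^[n] p).2 = g^[n] p.2 := by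
  induction n with
  | zero => rfl
  | succ n ih => rw [Function.iterate_succ_apply', Function.iterate_succ_apply', skewProduct, ih]

theorem skewProduct_iterate_zero (f : ℂ → ℂ) {g : ℂ → ℂ} (hg_fix : g 0 = 0) (h : ℂ × ℂ → ℂ)
    (z : ℂ) (n : ℕ) : (skewProduct f h g)^[n] (z, 0) = (f^[n] z, 0) := by
  induction n with
  | zero => rfl
  | succ n ih =>
    rw [Function.iterate_succ_apply', Function.iterate_succ_apply', ih]
    simp [skewProduct, hg_fix]

/-- Far to the right, the perturbation `w h(z, w)` of the Fatou function stays small along orbits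
near the invariant fiber, and the real parts of the first coordinates grow linearly. -/
theorem skewProduct_linear_growth {a : ℂ} (ha : 0 < a.re) {g : ℂ → ℂ} (hg : Differentiable ℂ g)
    (hg_fix : g 0 = 0) (hg_attr : ‖deriv g 0‖ < 1) {h : ℂ × ℂ → ℂ} (hh : Continuous h)
    {r₂ : ℝ} (hr₂ : 0 < r₂)
    (horder : orderFirst h r₂ < 1 ∨ (deriv g 0 = 0 ∧ orderFirst h r₂ < ⊤))
    {R : ℝ} (hR : 0 ≤ R) (hRa : Real.exp (-R) ≤ a.re / 4) {z₀ : ℂ} (hz₀ : R < z₀.re) :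
    ∀ᶠ p in 𝓝 (z₀, (0 : ℂ)), ∀ n : ℕ,
      a.re / 2 * n ≤ ((skewProduct (fatouFunction a) h g)^[n] p).1.re ∧
      ‖((skewProduct (fatouFunction a) h g)^[n] p).2‖ ≤ r₂ := by
  obtain ⟨ε, ρ, hrate, hρ, hdom⟩ := exists_attractionRate_dominating hg hg_fix hg_attr horder
  obtain ⟨r₀, hr₀⟩ := exists_norm_le_exp_rpow hh hρ
  obtain ⟨η, hη, hgη⟩ := hrate.exists_bound
  have hre : a.re ≤ ‖a‖ := Complex.re_le_norm a
  have hexpR : Real.exp (-R) ≤ 1 := Real.exp_le_one_iff.2 (by linarith)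
  -- `A + B n` bounds the first coordinates of the orbits
  set A : ℝ := max (‖z₀‖ + 1) r₀
  set B : ℝ := 2 * ‖a‖ + 1
  have hB : 0 < B := by positivity
  obtain ⟨C, hC⟩ := hdom A B hB
  have hC0 : 0 ≤ C := (mul_nonneg (hrate.nonneg 0) (Real.exp_pos _).le).trans (hC 0)
  -- `δ C ≤ Re a / 4` keeps the perturbation below `Re a / 4`
  set δ : ℝ := min (min η r₂) (a.re / 4 / (C + 1))
  have hδ : 0 < δ := lt_min (lt_min hη hr₂) (by positivity)
  have hδη : δ ≤ η := (min_le_left _ _).trans (min_le_left _ _)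
  have hδr : δ ≤ r₂ := (min_le_left _ _).trans (min_le_right _ _)
  have hδC : δ * C ≤ a.re / 4 := by
    have h1 : δ ≤ a.re / 4 / (C + 1) := min_le_right _ _
    rw [le_div_iff₀ (by positivity)] at h1
    linarith
  have hnear : ∀ᶠ p in 𝓝 (z₀, (0 : ℂ)), R < p.1.re ∧ ‖p.1‖ < ‖z₀‖ + 1 ∧ ‖p.2‖ < δ := by
    have h1 : IsOpen {p : ℂ × ℂ | R < p.1.re} :=
      isOpen_lt continuous_const (Complex.continuous_re.comp continuous_fst)
    have h2 : IsOpen {p : ℂ × ℂ | ‖p.1‖ < ‖z₀‖ + 1} :=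
      isOpen_lt continuous_fst.norm continuous_const
    have h3 : IsOpen {p : ℂ × ℂ | ‖p.2‖ < δ} := isOpen_lt continuous_snd.norm continuous_const
    refine (h1.inter (h2.inter h3)).mem_nhds ?_
    exact ⟨hz₀, by simp, by simpa using hδ⟩
  filter_upwards [hnear] with p ⟨hp1, hp2, hp3⟩
  have hw : ∀ n : ℕ, ‖((skewProduct (fatouFunction a) h g)^[n] p).2‖ ≤ δ * ε n := fun n => by
    rw [snd_skewProduct_iterate]
    exact hgη δ hδ hδη _ hp3.le n
  have hwr : ∀ n : ℕ, ‖((skewProduct (fatouFunction a) h g)^[n] p).2‖ ≤ r₂ := fun n =>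
    (hw n).trans ((mul_le_of_le_one_right hδ.le (hrate.le_one n)).trans hδr)
  have hz : ∀ n : ℕ, R + a.re / 2 * n ≤ ((skewProduct (fatouFunction a) h g)^[n] p).1.re ∧
      ‖((skewProduct (fatouFunction a) h g)^[n] p).1‖ ≤ A + B * n := by
    intro n
    induction n with
    | zero => simpa using ⟨hp1.le, hp2.le.trans (le_max_left _ _)⟩
    | succ n ih =>
      have hwn := hw n
      have hwrn := hwr n
      rw [Function.iterate_succ_apply']
      set q := (skewProduct (fatouFunction a) h g)^[n] p
      obtain ⟨ih1, ih2⟩ := ih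
      have hn : (0 : ℝ) ≤ n := n.cast_nonneg
      have hhq : ‖h q‖ ≤ Real.exp ((A + B * n) ^ ρ) := by
        refine hr₀ _ ?_ q ih2 hwrn
        exact (le_max_right _ _).trans (le_add_of_nonneg_right (by positivity))
      have herr : ‖q.2 * h q‖ ≤ a.re / 4 := by
        rw [norm_mul]
        calc ‖q.2‖ * ‖h q‖ ≤ δ * ε n * Real.exp ((A + B * n) ^ ρ) :=
              mul_le_mul hwn hhq (norm_nonneg _) (mul_nonneg hδ.le (hrate.nonneg n))
          _ = δ * (ε n * Real.exp ((A + B * n) ^ ρ)) := mul_assoc _ _ _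
          _ ≤ δ * C := mul_le_mul_of_nonneg_left (hC n) hδ.le
          _ ≤ a.re / 4 := hδC
      have hqR : R ≤ q.1.re := by
        have : 0 ≤ a.re / 2 * n := by positivity
        linarith
      have hexp := norm_exp_neg_le hqR
      have he1 := neg_le_of_abs_le (Complex.abs_re_le_norm (q.2 * h q))
      have he2 := neg_le_of_abs_le (Complex.abs_re_le_norm (Complex.exp (-q.1)))
      simp only [skewProduct, fatouFunction]
      constructor
      · simp only [Complex.add_re]
        push_cast
        linarith
      · have h1 := norm_add_le (q.1 + a + Complex.exp (-q.1)) (q.2 * h q)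
        have h2 := norm_add₃_le (a := q.1) (b := a) (c := Complex.exp (-q.1))
        have h3 : B * ((n + 1 : ℕ) : ℝ) = B * n + (2 * ‖a‖ + 1) := by
          push_cast
          ring
        rw [h3]
        linarith
  exact fun n => ⟨by linarith [(hz n).1], hwr n⟩

/-- Points of the invariant fiber over absorbed points lie in the Fatou set of the skew product:
some iterate moves them to where the skew product tends to `[1 : 0 : 0]` uniformly. -/
theorem mk_zero_mem_fatouSet_skewProduct {a : ℂ} (ha : 0 < a.re) {g : ℂ → ℂ}
    (hg : Differentiable ℂ g) (hg_fix : g 0 = 0) (hg_attr : ‖deriv g 0‖ < 1) {h : ℂ × ℂ → ℂ}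
    (hh : Differentiable ℂ h) {r₂ : ℝ} (hr₂ : 0 < r₂)
    (horder : orderFirst h r₂ < 1 ∨ (deriv g 0 = 0 ∧ orderFirst h r₂ < ⊤))
    {z : ℂ} (hz : z ∈ absorbedSet a) :
    (z, (0 : ℂ)) ∈ fatouSet toP2 (skewProduct (fatouFunction a) h g) := by
  set F := skewProduct (fatouFunction a) h g with hF
  have hFd : Differentiable ℂ F := differentiable_skewProduct (differentiable_fatouFunction a) hg hh
  set R : ℝ := max 0 (-Real.log (a.re / 4))
  have hRa : Real.exp (-R) ≤ a.re / 4 := by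
    rw [← Real.le_log_iff_exp_le (by positivity)]
    linarith [le_max_right 0 (-Real.log (a.re / 4))]
  obtain ⟨c, hc, N₀, hN₀⟩ := exists_linear_growth ha hz
  obtain ⟨N, hNR, hNN₀⟩ := (((tendsto_natCast_atTop_atTop.const_mul_atTop hc).eventually_gt_atTop
    R).and (eventually_ge_atTop N₀)).exists
  have hgrow := skewProduct_linear_growth ha hg hg_fix hg_attr hh.continuous hr₂ horder
    (le_max_left _ _) hRa (hNR.trans_le (hN₀.self_of_nhds N hNN₀))
  rw [← skewProduct_iterate_zero (fatouFunction a) hg_fix h z N, ← hF] at hgrow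
  obtain ⟨X, hX, hXo, hzX⟩ := _root_.eventually_nhds_iff.1
    ((hFd.continuous.iterate N).continuousAt.eventually hgrow)
  refine ⟨X, hXo, hzX, isNormalOn_iterates
    (fun n => holomorphicOn_toP2_comp (hFd.iterate n) X) inftyP2 fun ε hε => ?_⟩
  have hlim : Tendsto (fun m : ℕ => (a.re / 2 * m) ^ 2) atTop atTop :=
    (tendsto_pow_atTop two_ne_zero).comp
      (tendsto_natCast_atTop_atTop.const_mul_atTop (half_pos ha))
  filter_upwards [(tendsto_sub_atTop_nat N).eventually
    (hlim.eventually_gt_atTop ((1 + r₂ ^ 2) / ε ^ 2)), eventually_ge_atTop N] with n hn hnN x hx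
  obtain ⟨h1, h2⟩ := hX x hx (n - N)
  rw [← Function.iterate_add_apply, Nat.sub_add_cancel hnN] at h1 h2
  refine chordalDist_toP2_inftyP2_lt hε h2 (hn.trans_le ?_)
  have h3 := h1.trans (Complex.re_le_norm _)
  gcongr

end BakerBulging

theorem mainTheorem1 (a : ℂ) (ha : 0 < a.re)
    (g : ℂ → ℂ) (hg : Differentiable ℂ g) (hg_fix : g 0 = 0) (hg_attr : ‖deriv g 0‖ < 1)
    (h : ℂ × ℂ → ℂ) (hh : Differentiable ℂ h)
    (r₂ : ℝ) (hr₂ : 0 < r₂)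
    (horder : BakerBulging.orderFirst h r₂ < 1 ∨
      (deriv g 0 = 0 ∧ BakerBulging.orderFirst h r₂ < ⊤)) :
    ∃ B : Set ℂ,
      BakerBulging.IsBakerDomain (BakerBulging.fatouFunction a) B ∧
      (∀ R : ℝ, |Real.log a.re| < R → {z : ℂ | R < z.re} ⊆ B) ∧
      BakerBulging.Bulges
        (BakerBulging.skewProduct (BakerBulging.fatouFunction a) h g) B := by
  obtain ⟨B, hB, hBc, hBA, hHB⟩ := BakerBulging.exists_isBakerDomain ha
  refine ⟨B, hB, fun R hR z hz => hHB (hR.trans hz), ?_⟩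
  have hfatou : B ×ˢ {(0 : ℂ)} ⊆ BakerBulging.fatouSet BakerBulging.toP2
      (BakerBulging.skewProduct (BakerBulging.fatouFunction a) h g) := by
    rintro ⟨z, w⟩ ⟨hz, rfl⟩
    exact BakerBulging.mk_zero_mem_fatouSet_skewProduct ha hg hg_fix hg_attr hh hr₂ horder
      (hBA hz)
  have hz₀ : (((|Real.log a.re| + 1 : ℝ) : ℂ), (0 : ℂ)) ∈ B ×ˢ {(0 : ℂ)} := ⟨hHB (by simp), rfl⟩
  exact ⟨_, ⟨_, hfatou hz₀, rfl⟩, fun p hp => ⟨(hBc.prod isPreconnected_singleton)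
    |>.subset_connectedComponentIn hz₀ hfatou hp, hp.2⟩⟩
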